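/- For every integer $n \ge 1$ let $$r_4(n) := \bigl|\{(x_1,x_2,x_3,x_4) \in \mathbb{Z}^4 \;:\; n = x_1^2+x_2^2+x_3^2+x_4^2\}\bigr|$$ be the number of ordered quadruples of integers whose squares sum to $n$. Then $$r_4(n) \;=\; 8 \sum_{d \mid n,\; 4 \nmid d} d,$$ where the sum runs over the positive divisors $d$ of $n$ that are not divisible by $4$. -/

import Mathlib

/-- The set of quadruples `(x₁, x₂, x₃, x₄)` of integers with
`n = x₁ ^ 2 + x₂ ^ 2 + x₃ ^ 2 + x₄ ^ 2`. -/
def fourSquareReps (n : ℕ) : Set (ℤ × ℤ × ℤ × ℤ) :=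
  {x | (n : ℤ) = x.1 ^ 2 + x.2.1 ^ 2 + x.2.2.1 ^ 2 + x.2.2.2 ^ 2}

/-- Each coordinate of a representation lies between `-n` and `n`; hence there are only finitely
many representations, and their number is a genuine cardinality. -/
theorem fourSquareReps_finite (n : ℕ) : (fourSquareReps n).Finite := by
  have key : ∀ a s : ℤ, 0 ≤ s → (n : ℤ) = a ^ 2 + s → a ∈ Set.Icc (-(n : ℤ)) n := by
    intro a s hs h
    constructor <;> nlinarith [sq_nonneg a, Int.le_self_sq a, Int.le_self_sq (-a)]
  have hI := Set.finite_Icc (-(n : ℤ)) n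
  refine (hI.prod (hI.prod (hI.prod hI))).subset ?_
  rintro ⟨a, b, c, d⟩ h
  have h' : (n : ℤ) = a ^ 2 + b ^ 2 + c ^ 2 + d ^ 2 := h
  exact ⟨key a (b ^ 2 + c ^ 2 + d ^ 2) (by positivity) (by linarith),
    key b (a ^ 2 + c ^ 2 + d ^ 2) (by positivity) (by linarith),
    key c (a ^ 2 + b ^ 2 + d ^ 2) (by positivity) (by linarith),
    key d (a ^ 2 + b ^ 2 + c ^ 2) (by positivity) (by linarith)⟩

/-- `r4 n` is the number of ordered quadruples of integers (signs and order both count) whose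
squares sum to `n`. -/
noncomputable def r4 (n : ℕ) : ℕ := (fourSquareReps n).ncard

/-! By symmetry among five squares, the sum of n - 5x₁² over representations of n is 0, so ∑ (n -
5i²) r₄(n - i²) = 0 over i² ≤ n. The i = 0 coefficient is n ≠ 0, so this recursion and r₄(0) = 1
determine r₄. It remains to check it for 8S, where S(m) sums the divisors of m not divisible by 4,
with 8S(0) replaced by 1. Since S(m) is the sum of ±(2d - e) over de = m, this needs a signed cubic
sum over i² + de = n (`sum_squareAddMulReps`). Liouville-style involutions cancel that sum up to a
boundary, which is empty unless n is a square. -/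

open Finset

/-! ### Involutions on the triples with i² + de = n -/

/-- The triples `(i, d, e)` of integers with `i ^ 2 + d * e = n` and `d`, `e` positive. -/
noncomputable def squareAddMulReps (n : ℕ) : Finset (ℤ × ℤ × ℤ) :=
  {t ∈ Icc (-(n : ℤ)) n ×ˢ Icc 1 (n : ℤ) ×ˢ Icc 1 (n : ℤ) | t.1 ^ 2 + t.2.1 * t.2.2 = n}

theorem mem_squareAddMulReps {n : ℕ} {i d e : ℤ} :
    (i, d, e) ∈ squareAddMulReps n ↔ i ^ 2 + d * e = n ∧ 0 < d ∧ 0 < e := by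
  simp only [squareAddMulReps, mem_filter, mem_product, mem_Icc]
  constructor
  · rintro ⟨⟨-, ⟨hd, -⟩, he, -⟩, h⟩
    exact ⟨h, by omega, by omega⟩
  · rintro ⟨h, hd, he⟩
    refine ⟨⟨⟨?_, ?_⟩, ⟨hd, ?_⟩, he, ?_⟩, h⟩ <;>
      nlinarith [sq_nonneg i, Int.le_self_sq i, Int.le_self_sq (-i), mul_pos hd he]

/-- The sign that is `-1` when `d` and `e` are both even and `1` otherwise. -/
def paritySign (d e : ℤ) : ℤ := if Even e ∧ Even d then -1 else 1

theorem paritySign_congr {d e d' e' : ℤ} (hd : Even d ↔ Even d') (he : Even e ↔ Even e') :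
    paritySign d e = paritySign d' e' := by
  simp only [paritySign, hd, he]

/-- The weight `x * y * z` with sign, where `x = e - 2 * i`, `y = d + i` and
`z = 2 * d + 2 * i - e`. -/
def cubicWeight (t : ℤ × ℤ × ℤ) : ℤ :=
  paritySign t.2.1 t.2.2 * ((t.2.2 - 2 * t.1) * (t.2.1 + t.1) * (2 * t.2.1 + 2 * t.1 - t.2.2))

/-- Reflecting i kills odd powers of i; the left summand is the part of xyz even in i. -/
theorem sum_paritySign_mul_eq_sum_cubicWeight (n : ℕ) :
    ∑ t ∈ squareAddMulReps n, paritySign t.2.1 t.2.2 * (2 * t.2.1 - t.2.2) *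
        (t.2.1 * t.2.2 - 4 * t.1 ^ 2) = ∑ t ∈ squareAddMulReps n, cubicWeight t := by
  have h : ∑ t ∈ squareAddMulReps n, cubicWeight t =
      ∑ t ∈ squareAddMulReps n, cubicWeight (-t.1, t.2) := by
    refine sum_nbij' (fun t ↦ (-t.1, t.2)) (fun t ↦ (-t.1, t.2)) ?_ ?_ ?_ ?_ ?_
    all_goals rintro ⟨i, d, e⟩ ht
    all_goals simp_all [mem_squareAddMulReps]
  have h2 : ∑ t ∈ squareAddMulReps n, paritySign t.2.1 t.2.2 * (2 * t.2.1 - t.2.2) *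
        (t.2.1 * t.2.2 - 4 * t.1 ^ 2) * 2 =
      ∑ t ∈ squareAddMulReps n, (cubicWeight t + cubicWeight (-t.1, t.2)) :=
    sum_congr rfl fun t _ ↦ by simp only [cubicWeight]; ring
  rw [sum_add_distrib, ← h, ← sum_mul] at h2
  linarith

/-- The cubic weight after the substitution `y = d + i`, `f = e - 2 * i - d`. -/
def skewWeight (t : ℤ × ℤ × ℤ) : ℤ :=
  paritySign t.2.1 (t.2.1 + t.2.2) * ((t.2.1 + t.2.2) * t.1 * (t.2.1 - t.2.2))

/-- The involution fixes e, y and z, and negates x. -/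
theorem sum_cubicWeight_pos (n : ℕ) :
    ∑ t ∈ squareAddMulReps n with 0 < t.2.1 - t.2.2 + 2 * t.1, cubicWeight t = 0 := by
  have h : ∑ t ∈ squareAddMulReps n with 0 < t.2.1 - t.2.2 + 2 * t.1, cubicWeight t =
      ∑ t ∈ squareAddMulReps n with 0 < t.2.1 - t.2.2 + 2 * t.1, -cubicWeight t := by
    refine sum_nbij' (fun t ↦ (t.2.2 - t.1, t.2.1 - t.2.2 + 2 * t.1, t.2.2))
      (fun t ↦ (t.2.2 - t.1, t.2.1 - t.2.2 + 2 * t.1, t.2.2)) ?_ ?_ ?_ ?_ ?_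
    all_goals rintro ⟨i, d, e⟩ ht
    all_goals simp only [mem_filter, mem_squareAddMulReps] at ht ⊢
    · exact ⟨⟨by linarith, ht.2, ht.1.2.2⟩, by linarith⟩
    · exact ⟨⟨by linarith, ht.2, ht.1.2.2⟩, by linarith⟩
    · ext <;> dsimp only <;> ring
    · ext <;> dsimp only <;> ring
    · have : paritySign (d - e + 2 * i) e = paritySign d e := by
        simp only [paritySign]
        congr 1
        grind
      simp only [cubicWeight, this]
      ring
  rw [sum_neg_distrib] at h
  linarith

/-- The region's condition becomes f > 0, while the old e > 0 becomes the new region's condition. -/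
theorem sum_cubicWeight_neg (n : ℕ) :
    ∑ t ∈ squareAddMulReps n with t.2.1 - t.2.2 + 2 * t.1 < 0, cubicWeight t =
      ∑ t ∈ squareAddMulReps n with 0 < t.2.2 - t.2.1 + 2 * t.1, skewWeight t := by
  refine sum_nbij' (fun t ↦ (t.2.1 + t.1, t.2.1, t.2.2 - 2 * t.1 - t.2.1))
      (fun t ↦ (t.1 - t.2.1, t.2.1, t.2.2 + 2 * t.1 - t.2.1)) ?_ ?_ ?_ ?_ ?_
  all_goals rintro ⟨i, d, e⟩ ht
  all_goals simp only [mem_filter, mem_squareAddMulReps] at ht ⊢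
  · exact ⟨⟨by linarith, ht.1.2.1, by linarith⟩, by linarith⟩
  · exact ⟨⟨by linarith, ht.1.2.1, by linarith⟩, by linarith⟩
  · ext <;> dsimp only <;> ring
  · ext <;> dsimp only <;> ring
  · have : paritySign d (d + (e - 2 * i - d)) = paritySign d e :=
      paritySign_congr Iff.rfl (by grind)
    simp only [skewWeight, cubicWeight, this]
    ring

theorem sum_skewWeight (n : ℕ) : ∑ t ∈ squareAddMulReps n, skewWeight t = 0 := by
  have h : ∑ t ∈ squareAddMulReps n, skewWeight t = ∑ t ∈ squareAddMulReps n, -skewWeight t := by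
    refine sum_nbij' (fun t ↦ (-t.1, t.2.1, t.2.2)) (fun t ↦ (-t.1, t.2.1, t.2.2)) ?_ ?_ ?_ ?_ ?_
    all_goals rintro ⟨i, d, e⟩ ht
    all_goals simp_all [mem_squareAddMulReps, skewWeight]
  rw [sum_neg_distrib] at h
  linarith

theorem sum_skewWeight_neg (n : ℕ) :
    ∑ t ∈ squareAddMulReps n with t.2.2 - t.2.1 + 2 * t.1 < 0, skewWeight t =
      ∑ t ∈ squareAddMulReps n with 0 < t.2.2 - t.2.1 + 2 * t.1, skewWeight t := by
  refine sum_nbij' (fun t ↦ (-t.1, t.2.2, t.2.1)) (fun t ↦ (-t.1, t.2.2, t.2.1)) ?_ ?_ ?_ ?_ ?_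
  all_goals rintro ⟨i, d, e⟩ ht
  all_goals simp only [mem_filter, mem_squareAddMulReps] at ht ⊢
  · exact ⟨⟨by linarith, ht.1.2.2, ht.1.2.1⟩, by linarith⟩
  · exact ⟨⟨by linarith, ht.1.2.2, ht.1.2.1⟩, by linarith⟩
  · simp
  · simp
  · have : paritySign e (e + d) = paritySign d (d + e) := by
      simp only [paritySign]
      congr 1
      grind
    simp only [skewWeight, this]
    ring

theorem sum_filter_trichotomy {α : Type*} (s : Finset α) (g f : α → ℤ) :
    ∑ t ∈ s, f t = ∑ t ∈ s with 0 < g t, f t + ∑ t ∈ s with g t = 0, f t +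
      ∑ t ∈ s with g t < 0, f t := by
  simp only [sum_filter, ← sum_add_distrib]
  refine sum_congr rfl fun t _ ↦ ?_
  rcases lt_trichotomy (g t) 0 with h | h | h
  · simp [h, h.ne, h.not_gt]
  · simp [h]
  · simp [h, h.ne', h.not_gt]

/-- The total vanishes by oddness in i, and the two open regions have equal sums. -/
theorem two_mul_sum_skewWeight_pos (n : ℕ) :
    2 * ∑ t ∈ squareAddMulReps n with 0 < t.2.2 - t.2.1 + 2 * t.1, skewWeight t =
      -∑ t ∈ squareAddMulReps n with t.2.2 - t.2.1 + 2 * t.1 = 0, skewWeight t := by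
  have h := sum_filter_trichotomy (squareAddMulReps n) (fun t ↦ t.2.2 - t.2.1 + 2 * t.1) skewWeight
  rw [sum_skewWeight, sum_skewWeight_neg] at h
  linarith

theorem two_mul_sum_cubicWeight (n : ℕ) :
    2 * ∑ t ∈ squareAddMulReps n, cubicWeight t =
      2 * ∑ t ∈ squareAddMulReps n with t.2.1 - t.2.2 + 2 * t.1 = 0,
        (if Even t.2.1 then 1 else -1) * (t.2.1 + t.1) * (2 * t.1 ^ 2 - t.2.1 ^ 2) := by
  have h := sum_filter_trichotomy (squareAddMulReps n) (fun t ↦ t.2.1 - t.2.2 + 2 * t.1) cubicWeight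
  rw [sum_cubicWeight_pos, sum_cubicWeight_neg] at h
  -- Reflecting i puts both boundary sums on e = d + 2i, where n = (d + i)².
  have h' : ∑ t ∈ squareAddMulReps n with t.2.2 - t.2.1 + 2 * t.1 = 0, skewWeight t =
      ∑ t ∈ squareAddMulReps n with t.2.1 - t.2.2 + 2 * t.1 = 0, skewWeight (-t.1, t.2) := by
    refine sum_nbij' (fun t ↦ (-t.1, t.2)) (fun t ↦ (-t.1, t.2)) ?_ ?_ ?_ ?_ ?_
    all_goals rintro ⟨i, d, e⟩ ht
    all_goals simp only [mem_filter, mem_squareAddMulReps] at ht ⊢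
    · exact ⟨⟨by linarith, ht.1.2.1, ht.1.2.2⟩, by linarith⟩
    · exact ⟨⟨by linarith, ht.1.2.1, ht.1.2.2⟩, by linarith⟩
    · simp
    · simp
    · simp
  rw [h, mul_add, two_mul_sum_skewWeight_pos, h', zero_add, mul_sum, mul_sum,
    ← sum_neg_distrib, ← sum_add_distrib]
  refine sum_congr rfl ?_
  rintro ⟨i, d, e⟩ ht
  obtain rfl : e = d + 2 * i := by linarith [(mem_filter.1 ht).2]
  have h1 : paritySign d (d + 2 * i) = if Even d then -1 else 1 := by
    simp only [paritySign]
    congr 1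
    grind
  have h2 : paritySign d (d + (d + 2 * i)) = if Even d then -1 else 1 := by
    simp only [paritySign]
    congr 1
    grind
  simp only [cubicWeight, skewWeight, h1, h2]
  split_ifs <;> ring

/-! ### The boundary sum -/

/-- Used with c = s and m = 2s - 1; keeping m independent of c permits induction. -/
theorem sum_alternating_quadratic (c : ℤ) (m : ℕ) :
    2 * ∑ d ∈ Icc 1 m, (if Even (d : ℤ) then 1 else -1) * ((d : ℤ) ^ 2 - 4 * c * d + 2 * c ^ 2) =
      if Even (m : ℤ) then (m : ℤ) * (m + 1) - 4 * c * m
        else -((m : ℤ) * (m + 1) - 4 * c * (m + 1) + 4 * c ^ 2) := by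
  induction m with
  | zero => simp
  | succ m ih =>
    rw [sum_Icc_succ_top (by omega), mul_add, ih]
    push_cast
    simp only [Int.even_add_one]
    split_ifs <;> first | contradiction | ring

theorem sum_boundary_of_sq (s : ℕ) (hs : 0 < s) :
    ∑ t ∈ squareAddMulReps (s ^ 2) with t.2.1 - t.2.2 + 2 * t.1 = 0,
        (if Even t.2.1 then 1 else -1) * (t.2.1 + t.1) * (2 * t.1 ^ 2 - t.2.1 ^ 2) = (s : ℤ) ^ 2 := by
  have h : ∑ t ∈ squareAddMulReps (s ^ 2) with t.2.1 - t.2.2 + 2 * t.1 = 0,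
        (if Even t.2.1 then 1 else -1) * (t.2.1 + t.1) * (2 * t.1 ^ 2 - t.2.1 ^ 2) =
      ∑ d ∈ Icc 1 (2 * s - 1), (s : ℤ) * ((if Even (d : ℤ) then 1 else -1) *
        ((d : ℤ) ^ 2 - 4 * s * d + 2 * s ^ 2)) := by
    have key : ∀ i d e : ℤ, (i ^ 2 + d * e = (s ^ 2 : ℕ) ∧ 0 < d ∧ 0 < e) ∧ d - e + 2 * i = 0 →
        i = s - d := by
      rintro i d e ⟨⟨h, hd, he⟩, h0⟩
      obtain rfl : e = d + 2 * i := by linarith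
      have : (d + i) ^ 2 = (s : ℤ) ^ 2 := by push_cast at h; linarith
      have := (sq_eq_sq₀ (by linarith) (by positivity)).1 this
      linarith
    refine sum_nbij' (fun t ↦ t.2.1.toNat) (fun d ↦ ((s : ℤ) - d, (d : ℤ), 2 * (s : ℤ) - d))
      ?_ ?_ ?_ ?_ ?_
    · rintro ⟨i, d, e⟩ ht
      simp only [mem_filter, mem_squareAddMulReps] at ht
      have := key i d e ht
      simp only [mem_Icc]
      omega
    · intro d hd
      simp only [mem_Icc] at hd
      simp only [mem_filter, mem_squareAddMulReps]
      refine ⟨⟨by push_cast; ring, by omega, by omega⟩, by ring⟩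
    · rintro ⟨i, d, e⟩ ht
      simp only [mem_filter, mem_squareAddMulReps] at ht
      have := key i d e ht
      ext <;> dsimp only <;> omega
    · intro d hd
      simp
    · rintro ⟨i, d, e⟩ ht
      simp only [mem_filter, mem_squareAddMulReps] at ht
      have := key i d e ht
      dsimp only
      rw [Int.toNat_of_nonneg ht.1.2.1.le, this]
      ring
  have hq := sum_alternating_quadratic s (2 * s - 1)
  have hc : ((2 * s - 1 : ℕ) : ℤ) = 2 * s - 1 := by omega
  rw [hc, if_neg (by grind)] at hq
  rw [h, ← mul_sum]
  have : ∑ d ∈ Icc 1 (2 * s - 1), (if Even (d : ℤ) then (1 : ℤ) else -1) *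
      ((d : ℤ) ^ 2 - 4 * s * d + 2 * (s : ℤ) ^ 2) = (s : ℤ) := by
    linarith
  rw [this, sq]

theorem sum_boundary_of_not_isSquare (n : ℕ) (hn : ¬ IsSquare n) :
    {t ∈ squareAddMulReps n | t.2.1 - t.2.2 + 2 * t.1 = 0} = ∅ := by
  refine filter_eq_empty_iff.2 ?_
  rintro ⟨i, d, e⟩ ht h0
  obtain ⟨h, -⟩ := mem_squareAddMulReps.1 ht
  dsimp only at h0
  obtain rfl : e = d + 2 * i := by linarith
  refine hn ((Int.isSquare_natCast_iff).1 ⟨d + i, ?_⟩)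
  linarith

theorem sum_squareAddMulReps (n : ℕ) (hn : 0 < n) :
    ∑ t ∈ squareAddMulReps n, paritySign t.2.1 t.2.2 * (2 * t.2.1 - t.2.2) *
        (t.2.1 * t.2.2 - 4 * t.1 ^ 2) = if IsSquare n then (n : ℤ) else 0 := by
  rw [sum_paritySign_mul_eq_sum_cubicWeight,
    mul_left_cancel₀ two_ne_zero (two_mul_sum_cubicWeight n)]
  split_ifs with hs
  · obtain ⟨s, rfl⟩ := hs
    rw [← sq]
    have h := sum_boundary_of_sq s (Nat.pos_of_mul_pos_left hn)
    exact_mod_cast h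
  · rw [sum_boundary_of_not_isSquare n hs, sum_empty]

/-! ### Divisor sums as signed sums over factorizations -/

/-- Moves a factor 2 from the second entry to the first. -/
theorem sum_both_even_eq_sum_four_dvd (m : ℕ) :
    2 * ∑ p ∈ m.divisorsAntidiagonal with Even p.1 ∧ Even p.2, p.1 =
      ∑ p ∈ m.divisorsAntidiagonal with 4 ∣ p.1, p.1 := by
  rw [mul_sum]
  refine sum_nbij' (fun p ↦ (2 * p.1, p.2 / 2)) (fun p ↦ (p.1 / 2, 2 * p.2)) ?_ ?_ ?_ ?_ ?_
  all_goals rintro ⟨a, b⟩ h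
  all_goals simp only [mem_filter, Nat.mem_divisorsAntidiagonal] at h
  · obtain ⟨⟨hm, h0⟩, ⟨a, rfl⟩, b, rfl⟩ := h
    simp only [mem_filter, Nat.mem_divisorsAntidiagonal]
    refine ⟨⟨?_, h0⟩, by omega⟩
    rw [← hm, show (b + b) / 2 = b by omega]
    ring
  · obtain ⟨⟨hm, h0⟩, a, rfl⟩ := h
    simp only [mem_filter, Nat.mem_divisorsAntidiagonal]
    rw [show 4 * a / 2 = 2 * a by omega]
    exact ⟨⟨by rw [← hm]; ring, h0⟩, by simp, by simp⟩
  · obtain ⟨-, ⟨a, rfl⟩, b, rfl⟩ := h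
    ext <;> dsimp only <;> omega
  · obtain ⟨-, a, rfl⟩ := h
    ext <;> dsimp only <;> omega
  · rfl

/-- The sign subtracts exactly the divisors with 4 ∣ d. It is symmetric, so d and e have equal
signed sums. -/
theorem sum_paritySign_divisorsAntidiagonal (m : ℕ) :
    ∑ p ∈ m.divisorsAntidiagonal, paritySign p.1 p.2 * (2 * (p.1 : ℤ) - p.2) =
      ((∑ d ∈ m.divisors with ¬ 4 ∣ d, d : ℕ) : ℤ) := by
  have hswap : ∑ p ∈ m.divisorsAntidiagonal, paritySign p.1 p.2 * (p.2 : ℤ) =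
      ∑ p ∈ m.divisorsAntidiagonal, paritySign p.1 p.2 * (p.1 : ℤ) := by
    refine sum_nbij' Prod.swap Prod.swap ?_ ?_ ?_ ?_ ?_
    all_goals rintro ⟨a, b⟩ h
    all_goals simp only [Nat.mem_divisorsAntidiagonal, Prod.swap_prod_mk] at h ⊢
    · exact ⟨by rw [mul_comm, h.1], h.2⟩
    · exact ⟨by rw [mul_comm, h.1], h.2⟩
    · simp only [paritySign, and_comm]
  have hdiv : ∑ d ∈ m.divisors with ¬ 4 ∣ d, d =
      ∑ p ∈ m.divisorsAntidiagonal with ¬ 4 ∣ p.1, p.1 := by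
    rw [sum_filter, sum_filter,
      Nat.sum_divisorsAntidiagonal (fun d _ ↦ if ¬ 4 ∣ d then d else 0)]
  have h4 := sum_filter_add_sum_filter_not m.divisorsAntidiagonal (fun p ↦ 4 ∣ p.1) (fun p ↦ p.1)
  rw [← sum_both_even_eq_sum_four_dvd, ← hdiv] at h4
  have hsign : ∑ p ∈ m.divisorsAntidiagonal, paritySign p.1 p.2 * (p.1 : ℤ) =
      ∑ p ∈ m.divisorsAntidiagonal, (p.1 : ℤ) -
        2 * ∑ p ∈ m.divisorsAntidiagonal with Even p.1 ∧ Even p.2, (p.1 : ℤ) := by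
    rw [sum_filter, mul_sum, ← sum_sub_distrib]
    refine sum_congr rfl fun p _ ↦ ?_
    simp only [paritySign, Int.even_coe_nat, and_comm]
    split_ifs <;> ring
  have h4' : (2 * ∑ p ∈ m.divisorsAntidiagonal with Even p.1 ∧ Even p.2, (p.1 : ℤ)) +
      ((∑ d ∈ m.divisors with ¬ 4 ∣ d, d : ℕ) : ℤ) = ∑ p ∈ m.divisorsAntidiagonal, (p.1 : ℤ) := by
    exact_mod_cast h4
  have hsplit : ∑ p ∈ m.divisorsAntidiagonal, paritySign p.1 p.2 * (2 * (p.1 : ℤ) - p.2) =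
      2 * (∑ p ∈ m.divisorsAntidiagonal, paritySign p.1 p.2 * (p.1 : ℤ)) -
        ∑ p ∈ m.divisorsAntidiagonal, paritySign p.1 p.2 * (p.2 : ℤ) := by
    rw [mul_sum, ← sum_sub_distrib]
    exact sum_congr rfl fun p _ ↦ by ring
  rw [hsplit, hswap, hsign]
  linarith

theorem sum_squareAddMulReps_eq_sum_divisorsAntidiagonal (n : ℕ) (f : ℤ → ℤ → ℤ → ℤ) :
    ∑ t ∈ squareAddMulReps n, f t.1 t.2.1 t.2.2 = ∑ i ∈ Icc (-(n : ℤ)) n,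
      ∑ p ∈ ((n : ℤ) - i ^ 2).toNat.divisorsAntidiagonal, f i p.1 p.2 := by
  rw [sum_sigma']
  refine sum_nbij' (fun t ↦ ⟨t.1, t.2.1.toNat, t.2.2.toNat⟩) (fun t ↦ (t.1, (t.2.1 : ℤ), (t.2.2 : ℤ)))
    ?_ ?_ ?_ ?_ ?_
  · rintro ⟨i, d, e⟩ h
    have hi : i ∈ Icc (-(n : ℤ)) n := (mem_product.1 (mem_filter.1 h).1).1
    obtain ⟨h, hd, he⟩ := mem_squareAddMulReps.1 h
    lift d to ℕ using hd.le
    lift e to ℕ using he.le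
    have hde : (n : ℤ) - i ^ 2 = (d * e : ℕ) := by push_cast; linarith
    simp only [mem_sigma, Nat.mem_divisorsAntidiagonal, hde, Int.toNat_natCast]
    refine ⟨hi, trivial, ?_⟩
    exact_mod_cast (mul_pos hd he).ne'
  · rintro ⟨i, d, e⟩ h
    simp only [mem_sigma, Nat.mem_divisorsAntidiagonal] at h
    obtain ⟨-, h, h0⟩ := h
    have hpos : 0 < d * e := by omega
    have hde : ((d * e : ℕ) : ℤ) = n - i ^ 2 := by omega
    refine mem_squareAddMulReps.2 ⟨?_, ?_, ?_⟩
    · push_cast at hde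
      linarith
    · exact_mod_cast Nat.pos_of_mul_pos_right hpos
    · exact_mod_cast Nat.pos_of_mul_pos_left hpos
  · rintro ⟨i, d, e⟩ h
    obtain ⟨h, hd, he⟩ := mem_squareAddMulReps.1 h
    simp [hd.le, he.le]
  · rintro ⟨i, d, e⟩ h
    simp
  · rintro ⟨i, d, e⟩ h
    obtain ⟨h, hd, he⟩ := mem_squareAddMulReps.1 h
    simp [hd.le, he.le]

/-- Terms with i² ≥ n vanish: `toNat` gives 0, whose `divisors` is empty. -/
theorem sum_sub_mul_sum_divisors (n : ℕ) (hn : 0 < n) :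
    ∑ i ∈ Icc (-(n : ℤ)) n, ((n : ℤ) - 5 * i ^ 2) *
        ((∑ d ∈ ((n : ℤ) - i ^ 2).toNat.divisors with ¬ 4 ∣ d, d : ℕ) : ℤ) =
      if IsSquare n then (n : ℤ) else 0 := by
  rw [← sum_squareAddMulReps n hn, sum_squareAddMulReps_eq_sum_divisorsAntidiagonal n
    (fun i d e ↦ paritySign d e * (2 * d - e) * (d * e - 4 * i ^ 2))]
  refine sum_congr rfl fun i _ ↦ ?_
  rw [← sum_paritySign_divisorsAntidiagonal, mul_sum]
  refine sum_congr rfl ?_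
  rintro ⟨d, e⟩ h
  obtain ⟨h, h0⟩ := Nat.mem_divisorsAntidiagonal.1 h
  have hde : ((d * e : ℕ) : ℤ) = n - i ^ 2 := by dsimp only at h; omega
  push_cast at hde
  simp only [hde]
  ring

/-! ### The recursion from five squares -/

/-- The representations of `n` as an ordered sum of five squares. -/
noncomputable def fiveSquareReps (n : ℕ) : Finset (ℤ × ℤ × ℤ × ℤ × ℤ) :=
  {t ∈ Icc (-(n : ℤ)) n ×ˢ Icc (-(n : ℤ)) n ×ˢ Icc (-(n : ℤ)) n ×ˢ Icc (-(n : ℤ)) n ×ˢ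
      Icc (-(n : ℤ)) n |
    t.1 ^ 2 + t.2.1 ^ 2 + t.2.2.1 ^ 2 + t.2.2.2.1 ^ 2 + t.2.2.2.2 ^ 2 = n}

theorem mem_Icc_of_sq_le {n : ℕ} {i : ℤ} (h : i ^ 2 ≤ n) : i ∈ Icc (-(n : ℤ)) n := by
  rw [mem_Icc]
  constructor <;> linarith [Int.le_self_sq i, Int.le_self_sq (-i), neg_sq i]

theorem mem_fiveSquareReps {n : ℕ} {a b c d e : ℤ} :
    (a, b, c, d, e) ∈ fiveSquareReps n ↔ a ^ 2 + b ^ 2 + c ^ 2 + d ^ 2 + e ^ 2 = n := by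
  simp only [fiveSquareReps, mem_filter, mem_product, and_iff_right_iff_imp]
  intro h
  refine ⟨?_, ?_, ?_, ?_, ?_⟩ <;> apply mem_Icc_of_sq_le <;>
    linarith [sq_nonneg a, sq_nonneg b, sq_nonneg c, sq_nonneg d, sq_nonneg e]

theorem sum_fiveSquareReps (n : ℕ) : ∑ t ∈ fiveSquareReps n, ((n : ℤ) - 5 * t.1 ^ 2) = 0 := by
  have h1 : ∑ t ∈ fiveSquareReps n, t.2.1 ^ 2 = ∑ t ∈ fiveSquareReps n, t.1 ^ 2 := by
    refine sum_nbij' (fun t ↦ (t.2.1, t.1, t.2.2)) (fun t ↦ (t.2.1, t.1, t.2.2)) ?_ ?_ ?_ ?_ ?_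
    all_goals rintro ⟨a, b, c, d, e⟩ h
    all_goals simp only [mem_fiveSquareReps] at h ⊢
    all_goals linarith
  have h2 : ∑ t ∈ fiveSquareReps n, t.2.2.1 ^ 2 = ∑ t ∈ fiveSquareReps n, t.1 ^ 2 := by
    refine sum_nbij' (fun t ↦ (t.2.2.1, t.2.1, t.1, t.2.2.2))
      (fun t ↦ (t.2.2.1, t.2.1, t.1, t.2.2.2)) ?_ ?_ ?_ ?_ ?_
    all_goals rintro ⟨a, b, c, d, e⟩ h
    all_goals simp only [mem_fiveSquareReps] at h ⊢
    all_goals linarith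
  have h3 : ∑ t ∈ fiveSquareReps n, t.2.2.2.1 ^ 2 = ∑ t ∈ fiveSquareReps n, t.1 ^ 2 := by
    refine sum_nbij' (fun t ↦ (t.2.2.2.1, t.2.1, t.2.2.1, t.1, t.2.2.2.2))
      (fun t ↦ (t.2.2.2.1, t.2.1, t.2.2.1, t.1, t.2.2.2.2)) ?_ ?_ ?_ ?_ ?_
    all_goals rintro ⟨a, b, c, d, e⟩ h
    all_goals simp only [mem_fiveSquareReps] at h ⊢
    all_goals linarith
  have h4 : ∑ t ∈ fiveSquareReps n, t.2.2.2.2 ^ 2 = ∑ t ∈ fiveSquareReps n, t.1 ^ 2 := by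
    refine sum_nbij' (fun t ↦ (t.2.2.2.2, t.2.1, t.2.2.1, t.2.2.2.1, t.1))
      (fun t ↦ (t.2.2.2.2, t.2.1, t.2.2.1, t.2.2.2.1, t.1)) ?_ ?_ ?_ ?_ ?_
    all_goals rintro ⟨a, b, c, d, e⟩ h
    all_goals simp only [mem_fiveSquareReps] at h ⊢
    all_goals linarith
  have h : ∑ t ∈ fiveSquareReps n, ((n : ℤ) - 5 * t.1 ^ 2) =
      ∑ t ∈ fiveSquareReps n, (t.2.1 ^ 2 + t.2.2.1 ^ 2 + t.2.2.2.1 ^ 2 + t.2.2.2.2 ^ 2 -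
        4 * t.1 ^ 2) := by
    refine sum_congr rfl ?_
    rintro ⟨a, b, c, d, e⟩ h
    rw [← mem_fiveSquareReps.1 h]
    ring
  rw [h, sum_sub_distrib, sum_add_distrib, sum_add_distrib, sum_add_distrib, h1, h2, h3, h4,
    ← mul_sum]
  ring

/-- The filter is needed: for i² > n, `toNat` would give the spurious value `r4 0 = 1`. -/
theorem sum_fiveSquareReps_eq_sum_r4 (n : ℕ) (f : ℤ → ℤ) :
    ∑ t ∈ fiveSquareReps n, f t.1 =
      ∑ i ∈ Icc (-(n : ℤ)) n with i ^ 2 ≤ (n : ℤ), f i * r4 ((n : ℤ) - i ^ 2).toNat := by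
  have hcard (i : ℤ) : f i * r4 ((n : ℤ) - i ^ 2).toNat =
      ∑ _x ∈ (fourSquareReps_finite ((n : ℤ) - i ^ 2).toNat).toFinset, f i := by
    rw [sum_const, r4, Set.ncard_eq_toFinset_card _ (fourSquareReps_finite _), nsmul_eq_mul,
      mul_comm]
  simp only [hcard]
  rw [sum_sigma']
  refine sum_nbij' (fun t ↦ ⟨t.1, t.2⟩) (fun t ↦ (t.1, t.2)) ?_ ?_ (fun _ _ ↦ rfl) (fun _ _ ↦ rfl)
    (fun _ _ ↦ rfl)
  · rintro ⟨a, b, c, d, e⟩ h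
    rw [mem_fiveSquareReps] at h
    have ha : a ^ 2 ≤ n := by linarith [sq_nonneg b, sq_nonneg c, sq_nonneg d, sq_nonneg e]
    simp only [mem_sigma, mem_filter, Set.Finite.mem_toFinset, fourSquareReps, Set.mem_ofPred_eq]
    refine ⟨⟨mem_Icc_of_sq_le ha, ha⟩, ?_⟩
    rw [Int.toNat_of_nonneg (by linarith)]
    linarith
  · rintro ⟨a, b, c, d, e⟩ h
    simp only [mem_sigma, mem_filter, Set.Finite.mem_toFinset, fourSquareReps,
      Set.mem_ofPred_eq] at h
    obtain ⟨⟨-, ha⟩, h⟩ := h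
    rw [Int.toNat_of_nonneg (by linarith)] at h
    rw [mem_fiveSquareReps]
    linarith

theorem sum_sub_mul_r4 (n : ℕ) :
    ∑ i ∈ Icc (-(n : ℤ)) n with i ^ 2 ≤ (n : ℤ),
      ((n : ℤ) - 5 * i ^ 2) * r4 ((n : ℤ) - i ^ 2).toNat = 0 := by
  rw [← sum_fiveSquareReps_eq_sum_r4 n (fun i ↦ (n : ℤ) - 5 * i ^ 2), sum_fiveSquareReps]

theorem r4_zero : r4 0 = 1 := by
  rw [r4, Set.ncard_eq_one]
  refine ⟨(0, 0, 0, 0), ?_⟩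
  ext ⟨a, b, c, d⟩
  simp only [fourSquareReps, Set.mem_ofPred_eq, Set.mem_singleton_iff, Prod.mk.injEq]
  constructor
  · intro h
    push_cast at h
    refine ⟨?_, ?_, ?_, ?_⟩ <;> rw [← sq_eq_zero_iff] <;>
      linarith [sq_nonneg a, sq_nonneg b, sq_nonneg c, sq_nonneg d]
  · rintro ⟨rfl, rfl, rfl, rfl⟩
    simp

/-! ### The same recursion for divisor sums, and conclusion -/

/-- These terms carry the value 1 at argument 0; for n = s², i = ±s give -4n each, cancelling 8
times the divisor identity. -/
theorem sum_sub_over_sq_eq (n : ℕ) (hn : 0 < n) :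
    ∑ i ∈ Icc (-(n : ℤ)) n with i ^ 2 = (n : ℤ), ((n : ℤ) - 5 * i ^ 2) =
      -8 * if IsSquare n then (n : ℤ) else 0 := by
  split_ifs with hs
  · obtain ⟨s, rfl⟩ := hs
    have hs : 0 < s := Nat.pos_of_mul_pos_left hn
    have : {i ∈ Icc (-((s * s : ℕ) : ℤ)) (s * s : ℕ) | i ^ 2 = ((s * s : ℕ) : ℤ)} = {(s : ℤ), -(s : ℤ)} := by
      ext i
      simp only [mem_filter, mem_insert, mem_singleton]
      constructor
      · rintro ⟨-, h⟩
        rw [← sq_eq_sq_iff_eq_or_eq_neg, h]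
        push_cast
        ring
      · intro h
        have h : i ^ 2 = (s * s : ℕ) := by
          rw [sq_eq_sq_iff_eq_or_eq_neg.2 h]
          push_cast
          ring
        exact ⟨mem_Icc_of_sq_le h.le, h⟩
    rw [this, sum_pair (by omega)]
    push_cast
    ring
  · rw [mul_zero]
    refine sum_eq_zero fun i hi ↦ absurd ?_ hs
    rw [← Int.isSquare_natCast_iff, ← (mem_filter.1 hi).2]
    exact ⟨i, sq i⟩

theorem sum_sub_mul_eight_mul_sum_divisors (n : ℕ) (hn : 0 < n) :
    ∑ i ∈ Icc (-(n : ℤ)) n with i ^ 2 ≤ (n : ℤ), ((n : ℤ) - 5 * i ^ 2) *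
      ((if ((n : ℤ) - i ^ 2).toNat = 0 then 1 else
        8 * ∑ d ∈ ((n : ℤ) - i ^ 2).toNat.divisors with ¬ 4 ∣ d, d : ℕ) : ℤ) = 0 := by
  have h1 := sum_sub_mul_sum_divisors n hn
  have h2 := sum_sub_over_sq_eq n hn
  have h : ∑ i ∈ Icc (-(n : ℤ)) n with i ^ 2 ≤ (n : ℤ), ((n : ℤ) - 5 * i ^ 2) *
      ((if ((n : ℤ) - i ^ 2).toNat = 0 then 1 else
        8 * ∑ d ∈ ((n : ℤ) - i ^ 2).toNat.divisors with ¬ 4 ∣ d, d : ℕ) : ℤ) =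
      8 * (∑ i ∈ Icc (-(n : ℤ)) n, ((n : ℤ) - 5 * i ^ 2) *
        ((∑ d ∈ ((n : ℤ) - i ^ 2).toNat.divisors with ¬ 4 ∣ d, d : ℕ) : ℤ)) +
      ∑ i ∈ Icc (-(n : ℤ)) n with i ^ 2 = (n : ℤ), ((n : ℤ) - 5 * i ^ 2) := by
    rw [sum_filter, sum_filter, mul_sum, ← sum_add_distrib]
    refine sum_congr rfl fun i _ ↦ ?_
    rcases lt_trichotomy (i ^ 2) (n : ℤ) with hi | hi | hi
    · have : ((n : ℤ) - i ^ 2).toNat ≠ 0 := by omega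
      simp only [hi.le, hi.ne, this, if_true, if_false]
      push_cast
      ring
    · simp [hi]
    · have : ((n : ℤ) - i ^ 2).toNat = 0 := by omega
      simp [hi.not_ge, hi.ne', this]
  rw [h, h1, h2]
  ring

theorem r4_eq (n : ℕ) :
    r4 n = if n = 0 then 1 else 8 * ∑ d ∈ n.divisors with ¬ 4 ∣ d, d := by
  induction n using Nat.strong_induction_on with
  | _ n ih =>
    rcases Nat.eq_zero_or_pos n with rfl | hn
    · simp [r4_zero]
    have h := (sum_sub_mul_r4 n).trans (sum_sub_mul_eight_mul_sum_divisors n hn).symm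
    have h0 : (0 : ℤ) ∈ {i ∈ Icc (-(n : ℤ)) n | i ^ 2 ≤ (n : ℤ)} := by simp
    -- Isolate i = 0, the only term at n itself.
    rw [← add_sum_erase _ _ h0, ← add_sum_erase _ _ h0] at h
    have hrest : ∀ i ∈ {i ∈ Icc (-(n : ℤ)) n | i ^ 2 ≤ (n : ℤ)}.erase 0,
        ((n : ℤ) - 5 * i ^ 2) * r4 ((n : ℤ) - i ^ 2).toNat = ((n : ℤ) - 5 * i ^ 2) *
      ((if ((n : ℤ) - i ^ 2).toNat = 0 then 1 else
        8 * ∑ d ∈ ((n : ℤ) - i ^ 2).toNat.divisors with ¬ 4 ∣ d, d : ℕ) : ℤ) := by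
      intro i hi
      have : 0 < i ^ 2 := by have := (mem_erase.1 hi).1; positivity
      rw [ih ((n : ℤ) - i ^ 2).toNat (by omega)]
    rw [sum_congr rfl hrest] at h
    have h := mul_left_cancel₀ (by simp [hn.ne']) (add_right_cancel h)
    simpa using Int.natCast_inj.1 h

theorem mainTheorem7 (n : ℕ) (hn : 0 < n) :
    r4 n = 8 * ∑ d ∈ n.divisors with ¬ 4 ∣ d, d := by
  rw [r4_eq, if_neg hn.ne']
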